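/- Let $d\ge 1$, $\nu>0$ and let $\beta_-,\beta_+$ be real numbers with $\beta_--\beta_+=1$. A $d$-peakon configuration consists of positions $x_1<\dots<x_d$ in $\mathbb R$ and nonzero real masses $m_1,\dots,m_d$. Its peakon measure is $m=\sum_{j=1}^d m_j\delta_{x_j}$ and its total mass is $M=\sum_{j=1}^d m_j$. Put $$T(\lambda)=T_d\cdots T_1,\qquad T_j=I+\lambda m_j\begin{bmatrix}1&e^{-2\nu x_j}\\-e^{2\nu x_j}&-1\end{bmatrix},\qquad A(z)=z^d\,T(1/z)\begin{bmatrix}\beta_-&0\\0&\beta_+\end{bmatrix},$$ so that $A$ is a matrix polynomial in $z$. Let $C_d=\operatorname{tr}A(0)$ and let $Y$ be the curve $$w^2=P(z),\qquad P(z)=\tfrac14(\operatorname{tr}A(z))^2-\beta_-\beta_+z^{2d}.$$ If $C_d\ne0$, then $P(0)=C_d^2/4>0$, and near $z=0$ the upper (lower) sheet of $Y$ is $w=+\sqrt{P(z)}$ (respectively $w=-\sqrt{P(z)}$), where $\sqrt{\cdot}$ is the principal square root, positive at $P(0)$. The generalized Weyl function at a point $(z,w)$ of $Y$ is $W=\zeta_2/\zeta_1$,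 where $\zeta=(\zeta_1,\zeta_2)^{T}\neq0$ satisfies $A(z)\zeta=\bigl(w+\tfrac12\operatorname{tr}A(z)\bigr)\zeta$. **Theorem.** Fix $d,\nu,\beta_-,\beta_+$ as above. 1. For every configuration with $C_d>0$, the function $zW$ on the upper sheet is analytic in $z$ at $z=0$; write $zW=\sum_{k\ge 0}w_kz^k$, where $w_0=0$. Within the set of configurations with $C_d>0$, the first $2d$ terms of this expansion determine uniquely the peakon measure $m$, that is, the masses $m_1,\dots,m_d$ and the positions $x_1,\dots,x_d$, and hence also $A(z)$. This holds in both of the following senses: (a) the coefficients $w_1,\dots,w_{2d}$ alone determine $m$ and $A(z)$; (b) the coefficients $w_0,w_1,\dots,w_{2d-1}$ together with the total mass $M$ determine $m$ and $A(z)$. 2. Within the set of configurations with $C_d<0$, the same statements hold when $zW$ is taken on the lower sheet. -/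

import Mathlib

open Matrix Polynomial

noncomputable section

/-- A `d`-peakon configuration: positions `x₁ < ⋯ < x_d` and nonzero masses `m₁, …, m_d`
(with 0-based labels). -/
structure PeakonConfig (d : ℕ) where
  pos : Fin d → ℝ
  mass : Fin d → ℝ
  strictMono_pos : StrictMono pos
  mass_ne_zero : ∀ j, mass j ≠ 0

namespace PeakonConfig

variable {d : ℕ}

/-- The peakon measure `m = ∑ⱼ mⱼ δ_{xⱼ}`, a signed measure on the line. -/
def measure (p : PeakonConfig d) : MeasureTheory.SignedMeasure ℝ :=
  ∑ j, p.mass j • MeasureTheory.VectorMeasure.dirac (p.pos j) (1 : ℝ)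

/-- The total mass `M = ∑ⱼ mⱼ`. -/
def totalMass (p : PeakonConfig d) : ℝ := ∑ j, p.mass j

/-- The matrix `Xⱼ`, so that crossing `xⱼ` acts by `Tⱼ = I + λ mⱼ Xⱼ` on the coordinates of a
solution of `(D² - ν² - 2νλm)Φ = 0` in the basis `e^{νx}, e^{-νx}`. -/
def jump (ν : ℝ) (p : PeakonConfig d) (j : Fin d) : Matrix (Fin 2) (Fin 2) ℝ :=
  !![1, Real.exp (-2 * ν * p.pos j); -Real.exp (2 * ν * p.pos j), -1]

/-- The transition matrix `T(λ) = T_d ⋯ T₁`, `Tⱼ = I + λ mⱼ Xⱼ`. -/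
def transition (ν : ℝ) (p : PeakonConfig d) (l : ℂ) : Matrix (Fin 2) (Fin 2) ℂ :=
  (List.ofFn fun j : Fin d =>
    1 + (l * (p.mass j : ℂ)) • (p.jump ν j).map (algebraMap ℝ ℂ)).reverse.prod

/-- The matrix polynomial `A = z^d T(1/z) diag(β₋, β₊)`, written as the polynomial
`(z + m_d X_d) ⋯ (z + m₁ X₁) diag(β₋, β₊)`; see `higgsAt_eq_transition`. -/
def higgs (ν βm βp : ℝ) (p : PeakonConfig d) : Matrix (Fin 2) (Fin 2) ℝ[X] :=
  (List.ofFn fun j : Fin d =>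
    (X : ℝ[X]) • (1 : Matrix (Fin 2) (Fin 2) ℝ[X]) +
      (p.mass j • p.jump ν j).map C).reverse.prod * !![C βm, 0; 0, C βp]

/-- The value `A(z)` at a complex number `z`. -/
def higgsAt (ν βm βp : ℝ) (p : PeakonConfig d) (z : ℂ) : Matrix (Fin 2) (Fin 2) ℂ :=
  (p.higgs ν βm βp).map (aeval z)

/-- `C_d`, the coefficient of `z⁰` in `tr A(z)`. -/
def traceConst (ν βm βp : ℝ) (p : PeakonConfig d) : ℝ :=
  (p.higgs ν βm βp).trace.coeff 0

/-- The polynomial `P = (tr A)² / 4 - det(β) z^{2d}` of the curve `w² = P(z)`. -/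
def curvePoly (ν βm βp : ℝ) (p : PeakonConfig d) : ℝ[X] :=
  C (1 / 4) * (p.higgs ν βm βp).trace ^ 2 - C (βm * βp) * X ^ (2 * d)

/-- The upper sheet `w = +√P(z)`, with the principal square root: it is positive wherever `P` is
positive, in particular for large positive `z` and at `z = 0` (if `C_d ≠ 0`). -/
def upperSheet (ν βm βp : ℝ) (p : PeakonConfig d) (z : ℂ) : ℂ :=
  (aeval z (p.curvePoly ν βm βp)) ^ (1 / 2 : ℂ)

/-- The lower sheet `w = -√P(z)`. -/
def lowerSheet (ν βm βp : ℝ) (p : PeakonConfig d) (z : ℂ) : ℂ :=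
  -p.upperSheet ν βm βp z

end PeakonConfig

open Classical in
/-- The ratio `ζ₂ / ζ₁` for an eigenvector `ζ` of `A` with eigenvalue `w + tr(A)/2`
(and `0` if there is no eigenvector with `ζ₁ ≠ 0`).  For `w ≠ 0` it does not depend on
the eigenvector, see `eigenRatio_eq`. -/
def eigenRatio (A : Matrix (Fin 2) (Fin 2) ℂ) (w : ℂ) : ℂ :=
  if h : ∃ ζ : Fin 2 → ℂ, ζ 0 ≠ 0 ∧ A *ᵥ ζ = (w + A.trace / 2) • ζ then
    h.choose 1 / h.choose 0
  else 0

theorem eigenRatio_eq {A : Matrix (Fin 2) (Fin 2) ℂ} {w : ℂ} (hw : w ≠ 0) {ζ : Fin 2 → ℂ}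
    (h0 : ζ 0 ≠ 0) (hζ : A *ᵥ ζ = (w + A.trace / 2) • ζ) : eigenRatio A w = ζ 1 / ζ 0 := by
  have h : ∃ ζ : Fin 2 → ℂ, ζ 0 ≠ 0 ∧ A *ᵥ ζ = (w + A.trace / 2) • ζ := ⟨ζ, h0, hζ⟩
  rw [eigenRatio, dif_pos h]
  obtain ⟨hη0, hη⟩ := h.choose_spec
  generalize h.choose = η at hη0 hη
  have e0 := congrFun hζ 0
  have e1 := congrFun hζ 1
  have f0 := congrFun hη 0
  have f1 := congrFun hη 1
  simp only [Matrix.mulVec, dotProduct, Fin.sum_univ_two, Matrix.trace, Matrix.diag_apply,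
    Pi.smul_apply, smul_eq_mul] at e0 e1 f0 f1
  rw [div_eq_div_iff hη0 h0]
  by_contra hne
  have hne' : η 1 * ζ 0 - ζ 1 * η 0 ≠ 0 := sub_ne_zero.mpr hne
  have a : (A 0 0 - (w + (A 0 0 + A 1 1) / 2)) * (η 1 * ζ 0 - ζ 1 * η 0) = 0 := by
    linear_combination η 1 * e0 - ζ 1 * f0
  have b : (A 1 1 - (w + (A 0 0 + A 1 1) / 2)) * (η 1 * ζ 0 - ζ 1 * η 0) = 0 := by
    linear_combination ζ 0 * f1 - η 0 * e1
  have a' := (mul_eq_zero.mp a).resolve_right hne'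
  have b' := (mul_eq_zero.mp b).resolve_right hne'
  exact hw (by linear_combination (-1 / 2 : ℂ) * (a' + b'))

theorem PeakonConfig.higgsAt_eq_transition {d : ℕ} (ν βm βp : ℝ) (p : PeakonConfig d) {z : ℂ}
    (hz : z ≠ 0) : p.higgsAt ν βm βp z =
      z ^ d • (p.transition ν z⁻¹ * !![(βm : ℂ), 0; 0, (βp : ℂ)]) := by
  have key : ∀ L : List (Fin d),
      ((L.map fun j => (X : ℝ[X]) • (1 : Matrix (Fin 2) (Fin 2) ℝ[X]) +
        (p.mass j • p.jump ν j).map C).prod).map (aeval z : ℝ[X] →ₐ[ℝ] ℂ) =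
      z ^ L.length • (L.map fun j => (1 : Matrix (Fin 2) (Fin 2) ℂ) +
        (z⁻¹ * (p.mass j : ℂ)) • (p.jump ν j).map (algebraMap ℝ ℂ)).prod := by
    intro L
    induction L with
    | nil => ext i j; simp [Matrix.one_apply, apply_ite]
    | cons a L ih =>
      have hfac : ((X : ℝ[X]) • (1 : Matrix (Fin 2) (Fin 2) ℝ[X]) +
          (p.mass a • p.jump ν a).map C).map (aeval z : ℝ[X] →ₐ[ℝ] ℂ) =
          z • ((1 : Matrix (Fin 2) (Fin 2) ℂ) +
            (z⁻¹ * (p.mass a : ℂ)) • (p.jump ν a).map (algebraMap ℝ ℂ)) := by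
        ext i j
        have h1 : (aeval z) (if i = j then (1 : ℝ[X]) else 0) = if i = j then (1 : ℂ) else 0 := by
          split_ifs <;> simp
        simp only [Matrix.map_apply, Matrix.add_apply, Matrix.smul_apply, smul_eq_mul, map_add,
          map_mul, aeval_X, aeval_C, Matrix.one_apply, Complex.coe_algebraMap, h1]
        field_simp
      rw [List.map_cons, List.prod_cons, List.map_cons, List.prod_cons, List.length_cons,
        Matrix.map_mul, ih, hfac, pow_succ, Matrix.mul_smul, Matrix.smul_mul, smul_smul]
  have hL := key (List.finRange d).reverse
  rw [List.map_reverse, List.map_reverse, List.length_reverse, List.length_finRange,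
    ← List.ofFn_eq_map, ← List.ofFn_eq_map] at hL
  rw [higgsAt, higgs, Matrix.map_mul, hL, transition, Matrix.smul_mul]
  congr 2
  ext i j
  fin_cases i <;> fin_cases j <;> simp

namespace PeakonConfig

variable {d : ℕ}

/-- The generalized Weyl function `W` over `z`, on the sheet `w` of the curve. -/
def weyl (ν βm βp : ℝ) (p : PeakonConfig d) (w : ℂ → ℂ) (z : ℂ) : ℂ :=
  eigenRatio (p.higgsAt ν βm βp z) (w z)

/-- `z W` on the upper sheet, in the local parameter `z` around `0⁺`. -/
def zWeylUpper (ν βm βp : ℝ) (p : PeakonConfig d) (z : ℂ) : ℂ :=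
  z * p.weyl ν βm βp (p.upperSheet ν βm βp) z

/-- `z W` on the lower sheet, in the local parameter `z` around `0⁻`. -/
def zWeylLower (ν βm βp : ℝ) (p : PeakonConfig d) (z : ℂ) : ℂ :=
  z * p.weyl ν βm βp (p.lowerSheet ν βm βp) z

end PeakonConfig

/-- The `k`-th Taylor coefficient of `f` at `0`. -/
def taylorCoeffZero (f : ℂ → ℂ) (k : ℕ) : ℂ := iteratedDeriv k f 0 / (k.factorial : ℂ)

end

/-! ### Linear algebra of the factors `z + m X` -/

noncomputable section PeakonInverse

open Filter Topology Asymptotics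

/-! The Weyl function is the slope of an eigenvector, and its expansion at `z = 0` reveals the
peakons one at a time from the right, as in a continued fraction. On the chosen sheet the eigenvalue
at `z = 0` is `C_d ≠ 0`, so the eigenvector can be taken analytic with nonzero first entry, and
dividing by the eigenvalue writes it as `S(z) η(z)`, where `S` is the product of the factors `z + mⱼ
Xⱼ` and `η` is continuous at `0` (`IsRegularBranch.exists_eigenvector`).

For two configurations, agreement of the Weyl functions to order `n` says that the `wedge` of the
two eigenvectors is `O(z ^ n)`. Each `X` is nilpotent of rank one with image spanned by `(1, -E)`,
where `E = e^{2νx}`. Hence the value of the wedge at `0` compares the leftmost `E`'s; once these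
agree, the coefficient of `z` compares the masses; once both agree, the common factor has
determinant `z ^ 2` and can be removed at the cost of two orders. Induction
(`peakonList_eq_of_wedge_isBigO`) uses `2d` orders, or `2d - 1` if the total mass supplies the last
mass. -/

/-- The factor `z + m X` of the matrix polynomial, where `a = (E, m)` and `E = e^{2νx}`. -/
def peakonFactor (a : ℝ × ℝ) (z : ℂ) : Matrix (Fin 2) (Fin 2) ℂ :=
  !![z + a.2, a.2 * (a.1 : ℂ)⁻¹; -(a.2 * a.1), z - a.2]

/-- The product of the factors of a list, the first entry leftmost. -/
def peakonProd (L : List (ℝ × ℝ)) (z : ℂ) : Matrix (Fin 2) (Fin 2) ℂ :=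
  (L.map fun a => peakonFactor a z).prod

/-- The determinant of two vectors of the plane. -/
def wedge (x y : Fin 2 → ℂ) : ℂ := x 0 * y 1 - x 1 * y 0

theorem peakonProd_cons_mulVec (a : ℝ × ℝ) (L : List (ℝ × ℝ)) (z : ℂ) (x : Fin 2 → ℂ) :
    peakonProd (a :: L) z *ᵥ x = peakonFactor a z *ᵥ (peakonProd L z *ᵥ x) := by
  rw [peakonProd, List.map_cons, List.prod_cons, ← Matrix.mulVec_mulVec, peakonProd]

theorem continuous_peakonFactor (a : ℝ × ℝ) : Continuous (peakonFactor a) := by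
  refine continuous_matrix fun i j => ?_
  fin_cases i <;> fin_cases j <;> simp [peakonFactor] <;> fun_prop

theorem continuous_peakonProd (L : List (ℝ × ℝ)) : Continuous (peakonProd L) := by
  unfold peakonProd
  exact continuous_list_prod L fun a _ => continuous_peakonFactor a

theorem peakonFactor_mulVec_zero (a : ℝ × ℝ) (z : ℂ) (x : Fin 2 → ℂ) :
    (peakonFactor a z *ᵥ x) 0 = z * x 0 + a.2 * (x 0 + (a.1 : ℂ)⁻¹ * x 1) := by
  simp [peakonFactor, Matrix.mulVec, dotProduct, Fin.sum_univ_two]; ring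

theorem peakonFactor_mulVec_one (a : ℝ × ℝ) (ha : a.1 ≠ 0) (z : ℂ) (x : Fin 2 → ℂ) :
    (peakonFactor a z *ᵥ x) 1 = z * x 1 - a.2 * a.1 * (x 0 + (a.1 : ℂ)⁻¹ * x 1) := by
  have : (a.1 : ℂ) ≠ 0 := by exact_mod_cast ha
  simp [peakonFactor, Matrix.mulVec, dotProduct, Fin.sum_univ_two]; field_simp; ring

/-- At `z = 0` the factor is `m X`, and the kernel of `X` is cut out by the functional `x 0 + E⁻¹ *
x 1`. -/
theorem peakonFactor_mulVec_ne_zero {a : ℝ × ℝ} (ha : a.1 ≠ 0) {x : Fin 2 → ℂ}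
    (h : peakonFactor a 0 *ᵥ x ≠ 0) : (a.2 : ℂ) ≠ 0 ∧ x 0 + (a.1 : ℂ)⁻¹ * x 1 ≠ 0 := by
  refine ⟨fun h0 => h ?_, fun h0 => h ?_⟩ <;> ext i <;> fin_cases i <;>
    simp [peakonFactor_mulVec_zero, peakonFactor_mulVec_one a ha, h0]

theorem wedge_peakonFactor_zero {a b : ℝ × ℝ} (ha : a.1 ≠ 0) (hb : b.1 ≠ 0) (x y : Fin 2 → ℂ) :
    wedge (peakonFactor a 0 *ᵥ x) (peakonFactor b 0 *ᵥ y) =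
      (a.1 - b.1) * (a.2 * (x 0 + (a.1 : ℂ)⁻¹ * x 1)) * (b.2 * (y 0 + (b.1 : ℂ)⁻¹ * y 1)) := by
  simp only [wedge, peakonFactor_mulVec_zero, peakonFactor_mulVec_one a ha,
    peakonFactor_mulVec_one b hb]
  ring

/-- With equal `E` the term free of `z` vanishes because `X` has rank one; since `X` has trace zero,
the two mixed terms combine into one multiple of `m - n`. -/
theorem wedge_peakonFactor_eq {E : ℝ} (hE : E ≠ 0) (m n : ℝ) (z : ℂ) (x y : Fin 2 → ℂ) :
    wedge (peakonFactor (E, m) z *ᵥ x) (peakonFactor (E, n) z *ᵥ y) =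
      (z * wedge x y +
        E * (m - n) * (x 0 + (E : ℂ)⁻¹ * x 1) * (y 0 + (E : ℂ)⁻¹ * y 1)) * z := by
  have : (E : ℂ) ≠ 0 := by exact_mod_cast hE
  rw [wedge, wedge, peakonFactor_mulVec_zero, peakonFactor_mulVec_one _ (by exact hE),
    peakonFactor_mulVec_zero, peakonFactor_mulVec_one _ (by exact hE)]
  simp only
  field_simp
  ring

/-! ### Orders of vanishing at `0`, on punctured neighbourhoods so that `z` can be cancelled -/

theorem eq_zero_of_isBigO_pow_succ {f : ℂ → ℂ} {n : ℕ} (hf : ContinuousAt f 0)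
    (h : f =O[𝓝[≠] 0] fun z => z ^ (n + 1)) : f 0 = 0 := by
  have h1 : Tendsto (fun z : ℂ => z ^ (n + 1)) (𝓝[≠] 0) (𝓝 0) := by
    have : Tendsto (fun z : ℂ => z ^ (n + 1)) (𝓝 0) (𝓝 (0 ^ (n + 1))) :=
      (continuous_pow (n + 1)).tendsto 0
    rw [zero_pow n.succ_ne_zero] at this
    exact this.mono_left nhdsWithin_le_nhds
  exact tendsto_nhds_unique (hf.tendsto.mono_left nhdsWithin_le_nhds) (h.trans_tendsto h1)

theorem isBigO_pow_of_mul_self {f : ℂ → ℂ} {n : ℕ}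
    (h : (fun z => f z * z) =O[𝓝[≠] 0] fun z : ℂ => z ^ (n + 1)) :
    f =O[𝓝[≠] 0] fun z => z ^ n := by
  refine (h.mul (isBigO_refl (fun z : ℂ => z⁻¹) _)).congr' ?_ ?_ <;>
    filter_upwards [self_mem_nhdsWithin] with z hz
  · have : z ≠ 0 := hz
    field_simp
  · have : z ≠ 0 := hz
    rw [pow_succ]
    field_simp

theorem continuousAt_wedge {x y : ℂ → Fin 2 → ℂ} (hx : ContinuousAt x 0)
    (hy : ContinuousAt y 0) : ContinuousAt (fun z => wedge (x z) (y z)) 0 := by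
  rw [continuousAt_pi] at hx hy
  exact ((hx 0).mul (hy 1)).sub ((hx 1).mul (hy 0))

theorem continuousAt_mulVec {A : ℂ → Matrix (Fin 2) (Fin 2) ℂ} {x : ℂ → Fin 2 → ℂ}
    (hA : Continuous A) (hx : ContinuousAt x 0) : ContinuousAt (fun z => A z *ᵥ x z) 0 := by
  rw [continuousAt_pi] at hx ⊢
  intro i
  simp only [Matrix.mulVec, dotProduct, Fin.sum_univ_two]
  have h : ∀ j, ContinuousAt (fun z => A z i j) 0 := fun j =>
    (hA.matrix_elem i j).continuousAt
  exact ((h 0).mul (hx 0)).add ((h 1).mul (hx 1))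

/-! ### Removing one peakon -/

section Step

variable {a b : ℝ × ℝ} {x y : ℂ → Fin 2 → ℂ} {n : ℕ}

theorem fst_eq_of_wedge_isBigO (ha : a.1 ≠ 0) (hb : b.1 ≠ 0) (hx : ContinuousAt x 0)
    (hy : ContinuousAt y 0) (hx0 : peakonFactor a 0 *ᵥ x 0 ≠ 0)
    (hy0 : peakonFactor b 0 *ᵥ y 0 ≠ 0)
    (h : (fun z => wedge (peakonFactor a z *ᵥ x z) (peakonFactor b z *ᵥ y z)) =O[𝓝[≠] 0]
      fun z => z ^ (n + 1)) : a.1 = b.1 := by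
  have h0 := eq_zero_of_isBigO_pow_succ (continuousAt_wedge
    (continuousAt_mulVec (continuous_peakonFactor a) hx)
    (continuousAt_mulVec (continuous_peakonFactor b) hy)) h
  obtain ⟨h1, h2⟩ := peakonFactor_mulVec_ne_zero ha hx0
  obtain ⟨h3, h4⟩ := peakonFactor_mulVec_ne_zero hb hy0
  rw [wedge_peakonFactor_zero ha hb] at h0
  have h5 := (mul_eq_zero.mp ((mul_eq_zero.mp h0).resolve_right (mul_ne_zero h3 h4))).resolve_right
    (mul_ne_zero h1 h2)
  exact_mod_cast sub_eq_zero.mp h5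

theorem snd_eq_of_wedge_isBigO (ha : a.1 ≠ 0) (hab : a.1 = b.1) (hx : ContinuousAt x 0)
    (hy : ContinuousAt y 0) (hx0 : peakonFactor a 0 *ᵥ x 0 ≠ 0)
    (hy0 : peakonFactor b 0 *ᵥ y 0 ≠ 0)
    (h : (fun z => wedge (peakonFactor a z *ᵥ x z) (peakonFactor b z *ᵥ y z)) =O[𝓝[≠] 0]
      fun z => z ^ (n + 2)) : a.2 = b.2 := by
  obtain ⟨E, m⟩ := a
  obtain ⟨E', m'⟩ := b
  obtain rfl : E = E' := hab
  have hE : E ≠ 0 := ha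
  obtain ⟨-, h2⟩ := peakonFactor_mulVec_ne_zero ha hx0
  obtain ⟨-, h4⟩ := peakonFactor_mulVec_ne_zero (a := (E, m')) ha hy0
  simp only [wedge_peakonFactor_eq hE] at h
  have hw := continuousAt_wedge hx hy
  rw [continuousAt_pi] at hx hy
  -- After one factor `z` is cancelled, the value at `0` is `E (m - m')` times the two nonzero
  -- functionals.
  have h0 := eq_zero_of_isBigO_pow_succ
    ((continuousAt_id.mul hw).add (((continuousAt_const (y := (E : ℂ) * (m - m'))).mul
      ((hx 0).add ((continuousAt_const (y := (E : ℂ)⁻¹)).mul (hx 1)))).mul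
      ((hy 0).add ((continuousAt_const (y := (E : ℂ)⁻¹)).mul (hy 1))))) (isBigO_pow_of_mul_self h)
  simp only [Pi.add_apply, Pi.mul_apply, id, zero_mul, zero_add] at h0
  have h5 := (mul_eq_zero.mp ((mul_eq_zero.mp h0).resolve_right h4)).resolve_right h2
  have h6 := (mul_eq_zero.mp h5).resolve_left (by exact_mod_cast hE)
  exact_mod_cast sub_eq_zero.mp h6

theorem wedge_isBigO_of_peakonFactor (ha : a.1 ≠ 0)
    (h : (fun z => wedge (peakonFactor a z *ᵥ x z) (peakonFactor a z *ᵥ y z)) =O[𝓝[≠] 0]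
      fun z => z ^ (n + 2)) : (fun z => wedge (x z) (y z)) =O[𝓝[≠] 0] fun z => z ^ n := by
  obtain ⟨E, m⟩ := a
  simp only [wedge_peakonFactor_eq ha, sub_self, mul_zero, zero_mul, add_zero] at h
  have h1 := isBigO_pow_of_mul_self h
  simp only [mul_comm _ (wedge _ _)] at h1
  exact isBigO_pow_of_mul_self h1

end Step

/-- The vectors `x` and `y` need only be continuous at `0`, and nothing relates them; this lets the
induction keep them fixed while factors are stripped from the left. Equality of the sums survives
the removal of a common head. -/
theorem peakonList_eq_of_wedge_isBigO (L : List (ℝ × ℝ)) : ∀ (L' : List (ℝ × ℝ)) (n : ℕ)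
    (x y : ℂ → Fin 2 → ℂ), L.length = L'.length → (∀ a ∈ L, a.1 ≠ 0) → (∀ a ∈ L', a.1 ≠ 0) →
    ContinuousAt x 0 → ContinuousAt y 0 → peakonProd L 0 *ᵥ x 0 ≠ 0 →
    peakonProd L' 0 *ᵥ y 0 ≠ 0 →
    ((fun z => wedge (peakonProd L z *ᵥ x z) (peakonProd L' z *ᵥ y z)) =O[𝓝[≠] 0]
      fun z => z ^ n) →
    (n = 2 * L.length ∨
      (n + 1 = 2 * L.length ∧ (L.map Prod.snd).sum = (L'.map Prod.snd).sum)) → L = L' := by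
  induction L with
  | nil =>
    intro L' n x y hl
    intros
    exact (List.length_eq_zero_iff.mp hl.symm).symm
  | cons a L ih =>
    intro L' n x y hl hL hL' hx hy hx0 hy0 h hn
    obtain _ | ⟨b, L'⟩ := L'
    · simp at hl
    simp only [List.length_cons, Nat.add_right_cancel_iff] at hl hn
    simp only [peakonProd_cons_mulVec] at hx0 hy0 h
    have ha : a.1 ≠ 0 := hL a List.mem_cons_self
    have hb : b.1 ≠ 0 := hL' b List.mem_cons_self
    have hx' := continuousAt_mulVec (continuous_peakonProd L) hx
    have hy' := continuousAt_mulVec (continuous_peakonProd L') hy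
    have hab1 : a.1 = b.1 := by
      obtain ⟨k, rfl⟩ : ∃ k, n = k + 1 := ⟨n - 1, by omega⟩
      exact fst_eq_of_wedge_isBigO ha hb hx' hy' hx0 hy0 h
    -- Here `n = 1` with a single peakon left: its position is known, but its mass must come from
    -- the equality of sums.
    by_cases hn2 : n < 2
    · have hL0 : L = [] := List.length_eq_zero_iff.mp (by omega)
      subst hL0
      have hL0' : L' = [] := List.length_eq_zero_iff.mp hl.symm
      subst hL0'
      have hs := (hn.resolve_left (by simp; omega)).2
      rw [Prod.ext hab1 (by simpa using hs)]
    · obtain ⟨k, rfl⟩ : ∃ k, n = k + 2 := ⟨n - 2, by omega⟩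
      have hab : a = b := Prod.ext hab1 (snd_eq_of_wedge_isBigO ha hab1 hx' hy' hx0 hy0 h)
      subst hab
      congr 1
      refine ih L' k x y hl (fun c hc => hL c (List.mem_cons_of_mem _ hc))
        (fun c hc => hL' c (List.mem_cons_of_mem _ hc)) hx hy ?_ ?_
        (wedge_isBigO_of_peakonFactor ha h) ?_
      · intro h0; simp [h0] at hx0
      · intro h0; simp [h0] at hy0
      · simp only [List.map_cons, List.sum_cons, add_right_inj] at hn
        exact hn.imp (fun h => by omega) fun h => ⟨by omega, h.2⟩

/-! ### Slopes, eigenvectors and Taylor coefficients -/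

theorem wedge_eq_mul_sub_div {x y : Fin 2 → ℂ} (hx : x 0 ≠ 0) (hy : y 0 ≠ 0) :
    wedge x y = x 0 * y 0 * (y 1 / y 0 - x 1 / x 0) := by
  rw [wedge]
  field_simp

theorem det_peakonFactor {a : ℝ × ℝ} (ha : a.1 ≠ 0) (z : ℂ) : (peakonFactor a z).det = z ^ 2 := by
  have : (a.1 : ℂ) ≠ 0 := by exact_mod_cast ha
  rw [peakonFactor, Matrix.det_fin_two_of]
  field_simp
  ring

theorem det_peakonProd (L : List (ℝ × ℝ)) (hL : ∀ a ∈ L, a.1 ≠ 0) (z : ℂ) :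
    (peakonProd L z).det = z ^ (2 * L.length) := by
  induction L with
  | nil => simp [peakonProd]
  | cons a L ih =>
    rw [peakonProd, List.map_cons, List.prod_cons, Matrix.det_mul,
      det_peakonFactor (hL a List.mem_cons_self), ← peakonProd,
      ih fun c hc => hL c (List.mem_cons_of_mem _ hc), List.length_cons]
    ring

/-- By Cayley–Hamilton, if the trace minus `l` is the other eigenvalue of `A` then the columns of
`A - (tr A - l)` are eigenvectors for `l`. -/
theorem mulVec_sub_smul_eq {A : Matrix (Fin 2) (Fin 2) ℂ} {l : ℂ}
    (hl : l * (A.trace - l) = A.det) (x : Fin 2 → ℂ) :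
    A *ᵥ (A *ᵥ x - (A.trace - l) • x) = l • (A *ᵥ x - (A.trace - l) • x) := by
  rw [Matrix.det_fin_two, Matrix.trace_fin_two] at hl
  rw [Matrix.trace_fin_two]
  refine funext (Fin.forall_fin_two.mpr ⟨?_, ?_⟩) <;>
    simp only [Matrix.mulVec, dotProduct, Fin.sum_univ_two, Pi.sub_apply, Pi.smul_apply,
      smul_eq_mul]
  · linear_combination x 0 * hl
  · linear_combination x 1 * hl

theorem sub_isBigO_of_taylorCoeffZero {f g : ℂ → ℂ} {n : ℕ} (hf : AnalyticAt ℂ f 0)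
    (hg : AnalyticAt ℂ g 0) (h : ∀ k < n, taylorCoeffZero f k = taylorCoeffZero g k) :
    (fun z => f z - g z) =O[𝓝 0] fun z => z ^ n := by
  have hfg := hf.fun_sub hg
  have h1 : (n : ℕ∞) ≤ analyticOrderAt (fun z => f z - g z) 0 := by
    rw [natCast_le_analyticOrderAt_iff_iteratedDeriv_eq_zero hfg]
    intro k hk
    have h2 := h k hk
    have h3 : (k.factorial : ℂ) ≠ 0 := by exact_mod_cast k.factorial_ne_zero
    rw [taylorCoeffZero, taylorCoeffZero, div_left_inj' h3] at h2
    rw [iteratedDeriv_fun_sub hf.contDiffAt hg.contDiffAt, h2, sub_self]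
  obtain ⟨u, hu, he⟩ := (natCast_le_analyticOrderAt hfg).mp h1
  have h4 := (isBigO_refl (fun z : ℂ => z ^ n) (𝓝 0)).mul (hu.continuousAt.isBigO_one ℂ)
  simp only [mul_one] at h4
  refine h4.congr' ?_ .rfl
  filter_upwards [he] with z hz
  simp [hz]

/-! ### The spectral curve of a configuration and its branches near `z = 0` -/

namespace PeakonConfig

variable {d : ℕ} (ν βm βp : ℝ) (p : PeakonConfig d)

/-- The pairs `(e^{2νxⱼ}, mⱼ)`, from the rightmost peakon to the leftmost. -/
def peakonList : List (ℝ × ℝ) :=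
  (List.ofFn fun j : Fin d => (Real.exp (2 * ν * p.pos j), p.mass j)).reverse

theorem length_peakonList : (p.peakonList ν).length = d := by simp [peakonList]

theorem fst_ne_zero_of_mem_peakonList : ∀ a ∈ p.peakonList ν, a.1 ≠ 0 := by
  intro a ha
  simp only [peakonList, List.mem_reverse, List.mem_ofFn] at ha
  obtain ⟨j, rfl⟩ := ha
  exact (Real.exp_pos _).ne'

theorem sum_snd_peakonList : ((p.peakonList ν).map Prod.snd).sum = p.totalMass := by
  simp [peakonList, totalMass, List.map_ofFn, List.sum_ofFn, Function.comp_def, List.sum_reverse]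

theorem peakonList_injective (hν : ν ≠ 0) {p q : PeakonConfig d}
    (h : p.peakonList ν = q.peakonList ν) : p = q := by
  have h1 := List.ofFn_injective (List.reverse_injective h)
  have h2 : p.mass = q.mass := funext fun j => congrArg Prod.snd (congrFun h1 j)
  have h3 : p.pos = q.pos := funext fun j =>
    mul_left_cancel₀ (mul_ne_zero two_ne_zero hν)
      (Real.exp_injective (congrArg Prod.fst (congrFun h1 j)))
  cases p; cases q
  simp_all

theorem higgsAt_eq (z : ℂ) : p.higgsAt ν βm βp z =
    peakonProd (p.peakonList ν) z * !![(βm : ℂ), 0; 0, (βp : ℂ)] := by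
  have hB : (!![C βm, 0; 0, C βp] : Matrix (Fin 2) (Fin 2) ℝ[X]).map
      (aeval z : ℝ[X] →ₐ[ℝ] ℂ) = !![(βm : ℂ), 0; 0, (βp : ℂ)] := by
    ext i j
    fin_cases i <;> fin_cases j <;> simp
  rw [higgsAt, higgs, Matrix.map_mul, hB, peakonProd, peakonList]
  congr 1
  rw [← AlgHom.mapMatrix_apply, map_list_prod, List.map_reverse, List.map_reverse, List.map_ofFn,
    List.map_ofFn]
  congr 3
  funext j
  have hexp : Real.exp (-(2 * ν * p.pos j)) = (Real.exp (2 * ν * p.pos j))⁻¹ := Real.exp_neg _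
  ext i k
  fin_cases i <;> fin_cases k <;> simp [peakonFactor, jump, hexp, sub_eq_add_neg]

theorem trace_higgsAt (z : ℂ) :
    (p.higgsAt ν βm βp z).trace = aeval z (p.higgs ν βm βp).trace := by
  simp [higgsAt, Matrix.trace_fin_two]

theorem trace_higgsAt_zero : (p.higgsAt ν βm βp 0).trace = p.traceConst ν βm βp := by
  rw [trace_higgsAt, traceConst, ← Complex.coe_algebraMap, Polynomial.coeff_zero_eq_aeval_zero']

theorem aeval_curvePoly (z : ℂ) : aeval z (p.curvePoly ν βm βp) =
    (p.higgsAt ν βm βp z).trace ^ 2 / 4 - (p.higgsAt ν βm βp z).det := by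
  rw [trace_higgsAt, higgsAt_eq, Matrix.det_mul,
    det_peakonProd _ (p.fst_ne_zero_of_mem_peakonList ν), length_peakonList, Matrix.det_fin_two_of,
    curvePoly]
  simp
  ring

theorem aeval_curvePoly_zero (hd : 0 < d) :
    aeval (0 : ℂ) (p.curvePoly ν βm βp) = ((p.traceConst ν βm βp ^ 2 / 4 : ℝ) : ℂ) := by
  have h := p.trace_higgsAt_zero ν βm βp
  rw [trace_higgsAt] at h
  simp [curvePoly, h, hd.ne']
  ring

theorem analyticAt_higgsAt (i j : Fin 2) :
    AnalyticAt ℂ (fun z => p.higgsAt ν βm βp z i j) 0 := by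
  simp only [higgsAt, Matrix.map_apply]
  exact analyticAt_id.aeval_polynomial _

/-- `w` is an analytic branch of the curve near `z = 0`, through the point at which
`w + tr A(0) / 2` is the nonzero eigenvalue of `A(0)`. -/
structure IsRegularBranch (w : ℂ → ℂ) : Prop where
  analyticAt : AnalyticAt ℂ w 0
  sq_eq : ∀ z, w z ^ 2 = aeval z (p.curvePoly ν βm βp)
  apply_zero : w 0 = p.traceConst ν βm βp / 2

theorem upperSheet_sq (z : ℂ) :
    p.upperSheet ν βm βp z ^ 2 = aeval z (p.curvePoly ν βm βp) := by
  rw [upperSheet, one_div]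
  exact_mod_cast Complex.cpow_nat_inv_pow _ two_ne_zero

theorem upperSheet_zero (hd : 0 < d) :
    p.upperSheet ν βm βp 0 = ((|p.traceConst ν βm βp| / 2 : ℝ) : ℂ) := by
  rw [upperSheet, aeval_curvePoly_zero _ _ _ _ hd]
  have h1 : p.traceConst ν βm βp ^ 2 / 4 = (|p.traceConst ν βm βp| / 2) ^ 2 := by
    rw [div_pow, sq_abs]; norm_num
  have h2 : (1 / 2 : ℂ) = ((1 / 2 : ℝ) : ℂ) := by norm_num
  rw [h1, h2, ← Complex.ofReal_cpow (sq_nonneg _), ← Real.sqrt_eq_rpow,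
    Real.sqrt_sq (by positivity)]

theorem analyticAt_upperSheet (hd : 0 < d) (hC : p.traceConst ν βm βp ≠ 0) :
    AnalyticAt ℂ (p.upperSheet ν βm βp) 0 := by
  refine (analyticAt_id.aeval_polynomial (p.curvePoly ν βm βp)).cpow analyticAt_const ?_
  rw [id, aeval_curvePoly_zero _ _ _ _ hd, Complex.ofReal_mem_slitPlane]
  positivity

theorem isRegularBranch_upperSheet (hd : 0 < d) (hC : 0 < p.traceConst ν βm βp) :
    p.IsRegularBranch ν βm βp (p.upperSheet ν βm βp) where
  analyticAt := p.analyticAt_upperSheet ν βm βp hd hC.ne'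
  sq_eq := p.upperSheet_sq ν βm βp
  apply_zero := by rw [upperSheet_zero _ _ _ _ hd, abs_of_pos hC]; push_cast; rfl

theorem isRegularBranch_lowerSheet (hd : 0 < d) (hC : p.traceConst ν βm βp < 0) :
    p.IsRegularBranch ν βm βp (p.lowerSheet ν βm βp) where
  analyticAt := (p.analyticAt_upperSheet ν βm βp hd hC.ne).neg
  sq_eq z := by rw [lowerSheet, neg_sq, upperSheet_sq]
  apply_zero := by
    rw [lowerSheet, upperSheet_zero _ _ _ _ hd, abs_of_neg hC]
    push_cast
    ring

variable {ν βm βp p}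

/-- Near `z = 0` the eigenvector has the form `S(z) η(z)` with `A = S diag(β₋, β₊)`, and its
components are analytic, the first one nonzero. -/
theorem IsRegularBranch.exists_eigenvector {w : ℂ → ℂ} (hw : p.IsRegularBranch ν βm βp w)
    (hd : 0 < d) (hC : p.traceConst ν βm βp ≠ 0) :
    ∃ ζ η : ℂ → Fin 2 → ℂ, (∀ i, AnalyticAt ℂ (fun z => ζ z i) 0) ∧ ContinuousAt η 0 ∧
      ∀ᶠ z in 𝓝 0, ζ z 0 ≠ 0 ∧ p.weyl ν βm βp w z = ζ z 1 / ζ z 0 ∧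
        ζ z = peakonProd (p.peakonList ν) z *ᵥ η z := by
  have hC' : (p.traceConst ν βm βp : ℂ) ≠ 0 := by exact_mod_cast hC
  set A := p.higgsAt ν βm βp with hA
  have hA_an := p.analyticAt_higgsAt ν βm βp
  rw [← hA] at hA_an
  have htr_an : AnalyticAt ℂ (fun z => (A z).trace) 0 := by
    simp only [Matrix.trace_fin_two]
    exact (hA_an 0 0).fun_add (hA_an 1 1)
  have htr0 : (A 0).trace = p.traceConst ν βm βp := p.trace_higgsAt_zero ν βm βp
  -- The leftmost factor of `A(0)` is `m_d X_d`, so the columns of `A(0)` are multiples of `(1, -E)`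
  -- with `E = e^{2νx_d}`.
  obtain ⟨E, hE⟩ : ∃ E : ℂ, ∀ j, A 0 1 j = -E * A 0 0 j := by
    obtain ⟨a, L, haL⟩ := List.exists_cons_of_length_pos
      ((p.length_peakonList ν).symm ▸ hd : 0 < (p.peakonList ν).length)
    have ha : a.1 ≠ 0 := p.fst_ne_zero_of_mem_peakonList ν a (haL ▸ List.mem_cons_self)
    have ha' : (a.1 : ℂ) ≠ 0 := by exact_mod_cast ha
    refine ⟨a.1, fun j => ?_⟩
    rw [hA, higgsAt_eq, haL, peakonProd, List.map_cons, List.prod_cons, Matrix.mul_assoc,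
      Matrix.mul_apply, Matrix.mul_apply, Fin.sum_univ_two, Fin.sum_univ_two]
    simp only [peakonFactor, Matrix.of_apply, Matrix.cons_val', Matrix.cons_val_zero,
      Matrix.cons_val_one, Matrix.cons_val_fin_one]
    field_simp
    ring
  set l : ℂ → ℂ := fun z => w z + (A z).trace / 2 with hl
  have hl_an : AnalyticAt ℂ l 0 := hw.analyticAt.fun_add (htr_an.fun_div analyticAt_const two_ne_zero)
  have hl0 : l 0 = p.traceConst ν βm βp := by simp only [hl, htr0, hw.apply_zero]; ring
  have hld : ∀ z, l z * ((A z).trace - l z) = (A z).det := fun z => by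
    have h1 := hw.sq_eq z
    rw [aeval_curvePoly] at h1
    simp only [hl]
    linear_combination -h1
  -- This `x` spans the image of `A(0)`, so `A(0) x = C_d x`; as `tr A - l` vanishes at `0`, the
  -- vector `ζ 0` equals `C_d x`.
  set x : Fin 2 → ℂ := ![1, -E] with hx
  set ζ : ℂ → Fin 2 → ℂ := fun z => A z *ᵥ x - ((A z).trace - l z) • x with hζ
  have hζ_an : ∀ i, AnalyticAt ℂ (fun z => ζ z i) 0 := fun i => by
    simp only [hζ, Pi.sub_apply, Pi.smul_apply, smul_eq_mul, Matrix.mulVec, dotProduct,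
      Fin.sum_univ_two]
    exact (((hA_an i 0).fun_mul analyticAt_const).fun_add
      ((hA_an i 1).fun_mul analyticAt_const)).fun_sub
      ((htr_an.fun_sub hl_an).fun_mul analyticAt_const)
  have hζ0 : ζ 0 0 ≠ 0 := by
    have h1 : ζ 0 0 = p.traceConst ν βm βp := by
      rw [← htr0]
      simp only [hζ, hl0, htr0, sub_self, zero_smul, sub_zero]
      rw [← htr0]
      simp [hx, Matrix.mulVec, dotProduct, Fin.sum_univ_two, Matrix.trace_fin_two, hE 1]
      ring
    rwa [h1]
  have heig : ∀ z, A z *ᵥ ζ z = l z • ζ z := fun z => mulVec_sub_smul_eq (hld z) x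
  set B : Matrix (Fin 2) (Fin 2) ℂ := !![(βm : ℂ), 0; 0, (βp : ℂ)] with hB
  have hl0' : l 0 ≠ 0 := by rwa [hl0]
  -- From `A ζ = l ζ` and `A = S B` one gets `ζ = S (l⁻¹ B ζ)`; this needs `l 0 ≠ 0`, which is why
  -- the sheet matters.
  refine ⟨ζ, fun z => (l z)⁻¹ • (B *ᵥ ζ z), hζ_an, ?_, ?_⟩
  · exact (hl_an.continuousAt.inv₀ hl0').smul (continuousAt_mulVec continuous_const
      (continuousAt_pi.mpr fun i => (hζ_an i).continuousAt))
  · have hw0 : w 0 ≠ 0 := by rw [hw.apply_zero]; exact div_ne_zero hC' two_ne_zero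
    filter_upwards [(hζ_an 0).continuousAt.eventually_ne hζ0,
      hw.analyticAt.continuousAt.eventually_ne hw0, hl_an.continuousAt.eventually_ne hl0']
      with z h1 h2 h3
    refine ⟨h1, eigenRatio_eq h2 h1 (heig z), ?_⟩
    rw [Matrix.mulVec_smul, Matrix.mulVec_mulVec, ← higgsAt_eq, ← hA, heig, smul_smul,
      inv_mul_cancel₀ h3, one_smul]

theorem IsRegularBranch.analyticAt_mul_weyl {w : ℂ → ℂ} (hw : p.IsRegularBranch ν βm βp w)
    (hd : 0 < d) (hC : p.traceConst ν βm βp ≠ 0) :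
    AnalyticAt ℂ (fun z => z * p.weyl ν βm βp w z) 0 := by
  obtain ⟨ζ, η, hζ, -, h⟩ := hw.exists_eigenvector hd hC
  refine (analyticAt_id.fun_mul ((hζ 1).fun_div (hζ 0) h.self_of_nhds.1)).congr ?_
  filter_upwards [h] with z hz
  rw [hz.2.1, id]

/-! ### Comparing two configurations -/

variable {q : PeakonConfig d}

theorem IsRegularBranch.eq_of_isBigO {w w' : ℂ → ℂ} {n : ℕ} (hν : ν ≠ 0) (hd : 0 < d)
    (hw : p.IsRegularBranch ν βm βp w) (hw' : q.IsRegularBranch ν βm βp w')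
    (hp : p.traceConst ν βm βp ≠ 0) (hq : q.traceConst ν βm βp ≠ 0)
    (h : (fun z => z * p.weyl ν βm βp w z - z * q.weyl ν βm βp w' z) =O[𝓝 0]
      fun z => z ^ (n + 1))
    (hn : n = 2 * d ∨ (n + 1 = 2 * d ∧ p.totalMass = q.totalMass)) : p = q := by
  obtain ⟨ζ, η, hζ, hη, hp'⟩ := hw.exists_eigenvector hd hp
  obtain ⟨ξ, θ, hξ, hθ, hq'⟩ := hw'.exists_eigenvector hd hq
  -- Passing from `z W` to `W` costs one order.
  have h1 : (fun z => q.weyl ν βm βp w' z - p.weyl ν βm βp w z) =O[𝓝[≠] 0] fun z => z ^ n :=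
    isBigO_pow_of_mul_self ((h.mono nhdsWithin_le_nhds).neg_left.congr_left fun z => by ring)
  have h2 := (((hζ 0).fun_mul (hξ 0)).continuousAt.isBigO_one ℂ).mono
    (nhdsWithin_le_nhds (s := {0}ᶜ))
  refine peakonList_injective ν hν (peakonList_eq_of_wedge_isBigO (p.peakonList ν)
    (q.peakonList ν) n η θ (by simp only [length_peakonList])
    (p.fst_ne_zero_of_mem_peakonList ν) (q.fst_ne_zero_of_mem_peakonList ν) hη hθ ?_ ?_ ?_ ?_)
  · rw [← hp'.self_of_nhds.2.2]
    exact fun h0 => hp'.self_of_nhds.1 (congrFun h0 0)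
  · rw [← hq'.self_of_nhds.2.2]
    exact fun h0 => hq'.self_of_nhds.1 (congrFun h0 0)
  · refine (h2.mul h1).congr' ?_ (.of_forall fun z => one_mul _)
    filter_upwards [nhdsWithin_le_nhds hp', nhdsWithin_le_nhds hq'] with z hz hz'
    rw [← hz.2.2, ← hz'.2.2, wedge_eq_mul_sub_div hz.1 hz'.1, hz.2.1, hz'.2.1]
  · rwa [length_peakonList, sum_snd_peakonList, sum_snd_peakonList]

theorem IsRegularBranch.eq_of_taylorCoeffZero {w w' : ℂ → ℂ} (hν : ν ≠ 0) (hd : 0 < d)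
    (hw : p.IsRegularBranch ν βm βp w) (hw' : q.IsRegularBranch ν βm βp w')
    (hp : p.traceConst ν βm βp ≠ 0) (hq : q.traceConst ν βm βp ≠ 0)
    (h : (∀ k ∈ Finset.Icc 1 (2 * d), taylorCoeffZero (fun z => z * p.weyl ν βm βp w z) k =
        taylorCoeffZero (fun z => z * q.weyl ν βm βp w' z) k) ∨
      ((∀ k ∈ Finset.range (2 * d), taylorCoeffZero (fun z => z * p.weyl ν βm βp w z) k =
        taylorCoeffZero (fun z => z * q.weyl ν βm βp w' z) k) ∧ p.totalMass = q.totalMass)) :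
    p = q := by
  have hpa := hw.analyticAt_mul_weyl hd hp
  have hqa := hw'.analyticAt_mul_weyl hd hq
  obtain h | ⟨h, hM⟩ := h
  · refine hw.eq_of_isBigO (n := 2 * d) hν hd hw' hp hq
      (sub_isBigO_of_taylorCoeffZero hpa hqa fun k hk => ?_) (.inl rfl)
    obtain rfl | hk0 := Nat.eq_zero_or_pos k
    -- The coefficient `w₀` is zero for both because of the factor `z`, so the coefficients up to
    -- `2d` give order `2d + 1`.
    · simp [taylorCoeffZero]
    · exact h k (Finset.mem_Icc.mpr ⟨hk0, by omega⟩)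
  · refine hw.eq_of_isBigO (n := 2 * d - 1) hν hd hw' hp hq
      (sub_isBigO_of_taylorCoeffZero hpa hqa fun k hk => ?_) (.inr ⟨by omega, hM⟩)
    exact h k (Finset.mem_range.mpr (by omega))

end PeakonConfig

end PeakonInverse

theorem mainTheorem6 (d : ℕ) (hd : 0 < d) (ν βm βp : ℝ) (hν : 0 < ν) (hβ : βm - βp = 1) :
    ((∀ p : PeakonConfig d, 0 < p.traceConst ν βm βp →
        AnalyticAt ℂ (p.zWeylUpper ν βm βp) 0) ∧
      ∀ p q : PeakonConfig d, 0 < p.traceConst ν βm βp → 0 < q.traceConst ν βm βp →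
        ((∀ k ∈ Finset.Icc 1 (2 * d), taylorCoeffZero (p.zWeylUpper ν βm βp) k =
            taylorCoeffZero (q.zWeylUpper ν βm βp) k) ∨
          ((∀ k ∈ Finset.range (2 * d), taylorCoeffZero (p.zWeylUpper ν βm βp) k =
            taylorCoeffZero (q.zWeylUpper ν βm βp) k) ∧ p.totalMass = q.totalMass)) →
        p.measure = q.measure ∧ p.mass = q.mass ∧ p.pos = q.pos ∧
          p.higgs ν βm βp = q.higgs ν βm βp) ∧
    ((∀ p : PeakonConfig d, p.traceConst ν βm βp < 0 →
        AnalyticAt ℂ (p.zWeylLower ν βm βp) 0) ∧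
      ∀ p q : PeakonConfig d, p.traceConst ν βm βp < 0 → q.traceConst ν βm βp < 0 →
        ((∀ k ∈ Finset.Icc 1 (2 * d), taylorCoeffZero (p.zWeylLower ν βm βp) k =
            taylorCoeffZero (q.zWeylLower ν βm βp) k) ∨
          ((∀ k ∈ Finset.range (2 * d), taylorCoeffZero (p.zWeylLower ν βm βp) k =
            taylorCoeffZero (q.zWeylLower ν βm βp) k) ∧ p.totalMass = q.totalMass)) →
        p.measure = q.measure ∧ p.mass = q.mass ∧ p.pos = q.pos ∧
          p.higgs ν βm βp = q.higgs ν βm βp) := by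
  refine ⟨⟨fun p hp => ?_, fun p q hp hq h => ?_⟩, fun p hp => ?_, fun p q hp hq h => ?_⟩
  · exact (p.isRegularBranch_upperSheet ν βm βp hd hp).analyticAt_mul_weyl hd hp.ne'
  · obtain rfl := (p.isRegularBranch_upperSheet ν βm βp hd hp).eq_of_taylorCoeffZero hν.ne' hd
      (q.isRegularBranch_upperSheet ν βm βp hd hq) hp.ne' hq.ne' h
    exact ⟨rfl, rfl, rfl, rfl⟩
  · exact (p.isRegularBranch_lowerSheet ν βm βp hd hp).analyticAt_mul_weyl hd hp.ne
  · obtain rfl := (p.isRegularBranch_lowerSheet ν βm βp hd hp).eq_of_taylorCoeffZero hν.ne' hd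
      (q.isRegularBranch_lowerSheet ν βm βp hd hq) hp.ne hq.ne h
    exact ⟨rfl, rfl, rfl, rfl⟩
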